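/- Let $d\ge 2$. For $x\in\mathbb Z^d$ let $\gcd(x)\in\mathbb N=\{0,1,2,\dots\}$ be the greatest common divisor of its coordinates. For a finite nonempty $A\subset\mathbb Z^d$, let $\mu_{A,\gcd}$ be the law of the random labelling $x\mapsto \gcd(x+Y)$, where $Y$ is uniform in $A$; it is a probability measure on $\Omega_{\mathbb N}=\mathbb N^{\mathbb Z^d}$ (product topology, $\mathbb N$ discrete). For every prime $p$, set $W^p_0=\mathbb Z^d$ and, for $n\ge 1$, conditionally on $(W^p_0,\dots,W^p_{n-1})$, let $W^p_n$ be a uniformly chosen coset of $p^n\mathbb Z^d$ among those contained in $W^p_{n-1}$; do this independently for all primes $p$. Put $V_p(x)=\sup\{n\in\mathbb N: x\in W^p_n\}\in\{0,1,\dots,\infty\}$ and let the random gcd profile be $x\mapsto\prod_p p^{V_p(x)}\in\{0,1,\dots,\infty\}$ (with $p^\infty=\infty$, and the product set to $0$ if $V_p(x)=\infty$ for all $p$). Then the law of the random gcd profile, a priori a probability measure on $\{0,1,\dots,\infty\}^{\mathbb Z^d}$, is carried by $\Omega_{\mathbb N}$, i.e. it is the image under the inclusion of a probability measure $\mu_{\infty,\gcd}$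 on $\Omega_{\mathbb N}$, which depends only on $d$. Moreover, for every bounded convex $F\subset\mathbb R^d$ with nonempty interior, writing $F_r=\{x\in\mathbb Z^d: r^{-1}x\in F\}$ for $r>0$, the set $F_r$ is finite and nonempty for all sufficiently large $r$, and $\mu_{F_r,\gcd}$ converges weakly to $\mu_{\infty,\gcd}$ as the real number $r$ tends to infinity. -/

import Mathlib

open MeasureTheory ProbabilityTheory Filter Topology

noncomputable section

namespace GcdLabelling

/-- The gcd labelling of `ℤ^d`: the nonnegative gcd of the coordinates. -/
def gcdLabel (d : ℕ) : (Fin d → ℤ) → ℕ :=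
  fun x => Finset.univ.gcd fun i => (x i).natAbs

/-- The law of `τ_{-Y} gcd`, where `Y` is uniform in `A`, as a measure on `ℕ^(ℤ^d)`.
Here `translate y ω = τ_y ω` is the labelling `x ↦ ω (x - y)`. -/
def gcdViewMeasure (d : ℕ) (A : Set (Fin d → ℤ)) : Measure ((Fin d → ℤ) → ℕ) :=
  (uniformOn A).map fun Y => translate (-Y) (gcdLabel d)

theorem isProbabilityMeasure_gcdViewMeasure {d : ℕ} {A : Set (Fin d → ℤ)}
    (hA : A.Finite ∧ A.Nonempty) : IsProbabilityMeasure (gcdViewMeasure d A) := by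
  have := isProbabilityMeasure_uniformOn hA.1 hA.2
  exact Measure.isProbabilityMeasure_map (Measurable.of_discrete).aemeasurable

open Classical in
/-- The gcd labelling seen from a uniform point of `A`, as a probability measure. It is meaningful
for finite nonempty `A`; otherwise the value is an irrelevant Dirac mass. -/
def gcdView (d : ℕ) (A : Set (Fin d → ℤ)) : ProbabilityMeasure ((Fin d → ℤ) → ℕ) :=
  if hA : A.Finite ∧ A.Nonempty then
    ⟨gcdViewMeasure d A, isProbabilityMeasure_gcdViewMeasure hA⟩
  else ⟨Measure.dirac (gcdLabel d), inferInstance⟩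

/-- `F_r = {x ∈ ℤ^d : r⁻¹ x ∈ F}`. -/
def latticePoints {d : ℕ} (F : Set (EuclideanSpace ℝ (Fin d))) (r : ℝ) : Set (Fin d → ℤ) :=
  {x | r⁻¹ • WithLp.toLp 2 (fun i => (x i : ℝ)) ∈ F}

/-- The cosets of `p^n ℤ^d` in `ℤ^d`, indexed by residue vectors modulo `p^n`. -/
abbrev CosetIndex (d p n : ℕ) : Type := Fin d → ZMod (p ^ n)

/-- The coset of `p^n ℤ^d` with the given index, as a subset of `ℤ^d`. -/
def cosetSet {d p n : ℕ} (c : CosetIndex d p n) : Set (Fin d → ℤ) :=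
  {x | ∀ i, ((x i : ℤ) : ZMod (p ^ n)) = c i}

/-- The cosets of `p^(n+1) ℤ^d` lying inside a given coset of `p^n ℤ^d`. -/
def subcosets {d p n : ℕ} (c : CosetIndex d p n) : Set (CosetIndex d p (n + 1)) :=
  {c' | cosetSet c' ⊆ cosetSet c}

theorem subcosets_nonempty {d p n : ℕ} (c : CosetIndex d p n) : (subcosets c).Nonempty := by
  choose y hy using fun i => ZMod.intCast_surjective (c i)
  refine ⟨fun i => ((y i : ℤ) : ZMod (p ^ (n + 1))), fun x hx i => ?_⟩
  have h := (ZMod.intCast_eq_intCast_iff_dvd_sub _ _ _).1 (hx i)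
  rw [← hy i]
  exact (ZMod.intCast_eq_intCast_iff_dvd_sub _ _ _).2
    (dvd_trans (by exact_mod_cast pow_dvd_pow p (Nat.le_succ n)) h)

instance cosetIndex_finite (d p n : ℕ) [NeZero p] : Finite (CosetIndex d p n) :=
  inferInstanceAs (Finite (Fin d → ZMod (p ^ n)))

/-- One step of the random chain of cosets: given the cosets of levels `0, …, n`, the coset of level
`n + 1` is uniform among those lying inside the coset of level `n`. -/
def cosetStep (d p : ℕ) [NeZero p] (n : ℕ) :
    Kernel ((i : Finset.Iic n) → CosetIndex d p i) (CosetIndex d p (n + 1)) where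
  toFun h := uniformOn (subcosets (h ⟨n, Finset.mem_Iic.2 le_rfl⟩))
  measurable' := Measurable.of_discrete

instance cosetStep_isMarkovKernel (d p : ℕ) [NeZero p] (n : ℕ) :
    IsMarkovKernel (cosetStep d p n) :=
  ⟨fun _ => isProbabilityMeasure_uniformOn (Set.toFinite _) (subcosets_nonempty _)⟩

/-- The law of the random nested chain `(W_n^p)_n` of cosets for one `p`: it starts from `ℤ^d`, the
only coset of `p^0 ℤ^d`, and evolves according to `cosetStep`. -/
def chainLaw (d p : ℕ) [NeZero p] : Measure ((n : ℕ) → CosetIndex d p n) :=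
  Kernel.trajMeasure (Measure.dirac (0 : CosetIndex d p 0)) (cosetStep d p)

instance chainLaw_isProbabilityMeasure (d p : ℕ) [NeZero p] :
    IsProbabilityMeasure (chainLaw d p) := by
  unfold chainLaw; infer_instance

instance primes_neZero (p : Nat.Primes) : NeZero (p : ℕ) := ⟨p.2.ne_zero⟩

/-- One chain of coset indices for every prime. -/
abbrev Chains (d : ℕ) : Type := (p : Nat.Primes) → (n : ℕ) → CosetIndex d p n

/-- The joint law of independent random nested chains, one for every prime. -/
def chainsLaw (d : ℕ) : Measure (Chains d) :=
  Measure.infinitePi fun p : Nat.Primes => chainLaw d p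

/-- `V_p(x) = sup {n : x ∈ W_n^p}`, in `{0, 1, …, ∞}`. -/
def valuation {d : ℕ} (W : Chains d) (p : Nat.Primes) (x : Fin d → ℤ) : ℕ∞ :=
  ⨆ n : {n : ℕ // x ∈ cosetSet (W p n)}, ((n : ℕ) : ℕ∞)

/-- `p^v` for `v ∈ {0, 1, …, ∞}`, with `p^∞ = ∞`. -/
def extPow (p : ℕ) : ℕ∞ → ℕ∞
  | ⊤ => ⊤
  | (v : ℕ) => ((p ^ v : ℕ) : ℕ∞)

open Classical in
/-- The gcd profile `x ↦ ∏_p p^{V_p(x)}`, in `{0, 1, …, ∞}`. As all factors are at least `1`, the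
infinite product is the supremum of the finite products. By convention the value is `0` when all
the `V_p(x)` are infinite. -/
def gcdProfile {d : ℕ} (W : Chains d) (x : Fin d → ℤ) : ℕ∞ :=
  if ∀ p, valuation W p x = ⊤ then 0
  else ⨆ S : Finset Nat.Primes, ∏ p ∈ S, extPow p (valuation W p x)

/-- The law of the random gcd profile, on labellings of `ℤ^d` by `{0, 1, …, ∞}`. -/
def gcdProfileLaw (d : ℕ) : Measure ((Fin d → ℤ) → ℕ∞) :=
  (chainsLaw d).map gcdProfile

end GcdLabelling

end

/-! Both laws are compared with one finite model. Let `M = modulus N`, the product of `p ^ N` over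
primes `p ≤ N`. The labelling `x ↦ gcd (gcd(x + y), M)` depends only on `y` mod `M`, and its label
at `x` is the true one as soon as `1 ≤ gcd(x + y) ≤ N`. The random profile fits the same model: by
the Chinese remainder theorem the cosets `W p N`, `p ≤ N`, form one residue class mod `M`, and the
truncated labelling seen from minus that class agrees with the profile wherever the latter is at
most `N` (`IsRegular.truncatedView_residue`).

In the model the two sources of randomness agree. The residue of the chains is exactly uniform
(`chainsLaw_residue_eq`). The residue of a uniform point of `F_r` is asymptotically uniform, because
these sets have small boundary: they are asymptotically invariant under translation
(`tendsto_shiftLoss_latticePoints`), and this forces equidistribution in every finite quotient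
(`tendsto_card_fiber_div`).

It remains to control truncation. In `F_r` the proportion of points with label zero or above `N` is
eventually at most `C / (N + 1)`, with `C` free of `N` (`exists_card_filter_gcdLabel_div_le`). For
the profile, Borel–Cantelli gives almost sure finiteness, so the tail vanishes. Both bounds rest on
convergence of `∑ m⁻ᵈ`, hence on `d ≥ 2`. Events depending on finitely many labels then converge,
which suffices for weak convergence. -/

open scoped ENNReal

noncomputable section

namespace GcdLabelling

/-! ### Asymptotically invariant finite sets and equidistribution in finite quotients. -/

section Folner

variable {G : Type*} [AddCommGroup G] [DecidableEq G]

/-- The proportion of points of `A` which leave `A` when translated by `v`. -/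
def shiftLoss (A : Finset G) (v : G) : ℝ :=
  ((A.filter fun z => z + v ∉ A).card : ℝ) / A.card

theorem shiftLoss_nonneg (A : Finset G) (v : G) : 0 ≤ shiftLoss A v := by
  unfold shiftLoss; positivity

theorem shiftLoss_zero (A : Finset G) : shiftLoss A 0 = 0 := by
  have : A.filter (fun z => z + 0 ∉ A) = ∅ := by
    ext z; simp
  simp [shiftLoss]

theorem shiftLoss_add_le (A : Finset G) (u v : G) :
    shiftLoss A (u + v) ≤ shiftLoss A u + shiftLoss A v := by
  unfold shiftLoss
  rw [← add_div]
  gcongr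
  have h1 : A.filter (fun z => z + (u + v) ∉ A) ⊆
      A.filter (fun z => z + u ∉ A) ∪ A.filter (fun z => z + u ∈ A ∧ z + u + v ∉ A) := by
    intro z hz
    simp only [Finset.mem_union, Finset.mem_filter, ← add_assoc] at hz ⊢
    tauto
  have h2 : (A.filter (fun z => z + u ∈ A ∧ z + u + v ∉ A)).card ≤
      (A.filter (fun z => z + v ∉ A)).card := by
    refine Finset.card_le_card_of_injOn (· + u) (fun z hz => ?_) (add_left_injective u).injOn
    simp only [Finset.coe_filter, Set.mem_ofPred_eq] at hz ⊢
    exact hz.2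
  exact_mod_cast (Finset.card_le_card h1).trans ((Finset.card_union_le _ _).trans (by gcongr))

/-- Translation by `v` injects the points that stay in `A` under `v` into those that stay under
`-v`; the points that leave are the complements. -/
theorem shiftLoss_neg_le (A : Finset G) (v : G) : shiftLoss A (-v) ≤ shiftLoss A v := by
  unfold shiftLoss
  refine div_le_div_of_nonneg_right (Nat.cast_le.2 ?_) (by positivity)
  have h1 := Finset.card_filter_add_card_filter_not (s := A) (fun z => z + v ∈ A)
  have h2 := Finset.card_filter_add_card_filter_not (s := A) (fun z => z + -v ∈ A)
  have h3 : (A.filter (fun z => z + v ∈ A)).card ≤ (A.filter (fun z => z + -v ∈ A)).card := by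
    refine Finset.card_le_card_of_injOn (· + v) (fun z hz => ?_) (add_left_injective v).injOn
    simp only [Finset.coe_filter, Set.mem_ofPred_eq] at hz ⊢
    exact ⟨hz.2, by simpa using hz.1⟩
  omega

variable {ι : Type*} {l : Filter ι} {A : ι → Finset G}

/-- The translations under which a net of finite sets is asymptotically invariant. -/
def asymptoticStabilizer (l : Filter ι) (A : ι → Finset G) : AddSubgroup G where
  carrier := {v | Tendsto (fun i => shiftLoss (A i) v) l (𝓝 0)}
  zero_mem' := by simpa [shiftLoss_zero] using tendsto_const_nhds
  add_mem' := fun {u v} hu hv =>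
    squeeze_zero (fun i => shiftLoss_nonneg _ _) (fun i => shiftLoss_add_le _ _ _)
      (by simpa using Tendsto.add hu hv)
  neg_mem' := fun {v} hv =>
    squeeze_zero (fun i => shiftLoss_nonneg _ _) (fun i => shiftLoss_neg_le _ _) hv

variable {H : Type*} [AddCommGroup H] [DecidableEq H]

/-- Translation by `v` carries the fibre over `h` into the fibre over `h + f v`, except for points
pushed out of `A`. -/
theorem card_fiber_div_sub_le_shiftLoss (A : Finset G) (f : G →+ H) (h : H) (v : G) :
    ((A.filter fun z => f z = h).card : ℝ) / A.card -
      ((A.filter fun z => f z = h + f v).card : ℝ) / A.card ≤ shiftLoss A v := by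
  unfold shiftLoss
  rw [sub_le_iff_le_add, ← add_div]
  gcongr
  have h1 : A.filter (fun z => f z = h) ⊆
      A.filter (fun z => z + v ∉ A) ∪ A.filter (fun z => f z = h ∧ z + v ∈ A) := by
    intro z hz
    simp only [Finset.mem_union, Finset.mem_filter] at hz ⊢
    tauto
  have h2 : (A.filter (fun z => f z = h ∧ z + v ∈ A)).card ≤
      (A.filter (fun z => f z = h + f v)).card := by
    refine Finset.card_le_card_of_injOn (· + v) (fun z hz => ?_) (add_left_injective v).injOn
    simp only [Finset.coe_filter, Set.mem_ofPred_eq] at hz ⊢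
    exact ⟨hz.2.2, by rw [map_add, hz.2.1]⟩
  exact_mod_cast (Finset.card_le_card h1).trans ((Finset.card_union_le _ _).trans (by gcongr))

variable [Fintype H]

/-- Any two fibre proportions differ by `o(1)`, since surjectivity provides a translation between
them, and all of them sum to one. -/
theorem tendsto_card_fiber_div (hA : ∀ v, Tendsto (fun i => shiftLoss (A i) v) l (𝓝 0))
    (hne : ∀ᶠ i in l, (A i).Nonempty) (f : G →+ H) (hf : Function.Surjective f) (h : H) :
    Tendsto (fun i => (((A i).filter fun z => f z = h).card : ℝ) / (A i).card) l
      (𝓝 (1 / Fintype.card H)) := by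
  set n : H → ι → ℝ := fun h i => (((A i).filter fun z => f z = h).card : ℝ) / (A i).card with hn
  have hdiff : ∀ h', Tendsto (fun i => n h i - n h' i) l (𝓝 0) := by
    intro h'
    obtain ⟨v, hv⟩ := hf (h' - h)
    refine tendsto_of_tendsto_of_tendsto_of_le_of_le (g := fun i => -shiftLoss (A i) (-v))
      (h := fun i => shiftLoss (A i) v) (by simpa using (hA (-v)).neg) (hA v)
      (fun i => ?_) (fun i => ?_)
    · have := card_fiber_div_sub_le_shiftLoss (A i) f h' (-v)
      rw [map_neg, hv, neg_sub, add_sub_cancel] at this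
      simp only [hn]
      linarith
    · have := card_fiber_div_sub_le_shiftLoss (A i) f h v
      rwa [hv, add_sub_cancel] at this
  have hsum : Tendsto (fun i => ∑ h', (n h i - n h' i)) l (𝓝 0) := by
    simpa using tendsto_finsetSum Finset.univ fun h' _ => hdiff h'
  have hc : (Fintype.card H : ℝ) ≠ 0 := by exact_mod_cast Fintype.card_ne_zero
  have key : ∀ᶠ i in l, (∑ h', (n h i - n h' i) + 1) / Fintype.card H = n h i := by
    filter_upwards [hne] with i hi
    have h1 : ∑ h', n h' i = 1 := by
      simp only [hn]
      rw [← Finset.sum_div, div_eq_one_iff_eq (by exact_mod_cast hi.card_pos.ne')]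
      exact_mod_cast (Finset.card_eq_sum_card_fiberwise (f := f) (t := Finset.univ)
        (fun _ _ => Finset.mem_coe.2 (Finset.mem_univ _))).symm
    rw [Finset.sum_sub_distrib, h1]
    simp only [Finset.sum_const, Finset.card_univ, nsmul_eq_mul]
    field_simp
    ring
  refine Tendsto.congr' key ?_
  simpa using (hsum.add_const 1).div_const (Fintype.card H : ℝ)

theorem tendsto_card_filter_map_mem_div
    (hA : ∀ v, Tendsto (fun i => shiftLoss (A i) v) l (𝓝 0))
    (hne : ∀ᶠ i in l, (A i).Nonempty) (f : G →+ H) (hf : Function.Surjective f) (B : Finset H) :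
    Tendsto (fun i => (((A i).filter fun z => f z ∈ B).card : ℝ) / (A i).card) l
      (𝓝 (B.card / Fintype.card H)) := by
  have h1 : ∀ i, (((A i).filter fun z => f z ∈ B).card : ℝ) / (A i).card =
      ∑ h ∈ B, (((A i).filter fun z => f z = h).card : ℝ) / (A i).card := by
    intro i
    rw [← Finset.sum_div]
    congr 1
    norm_cast
    rw [Finset.card_eq_sum_card_fiberwise (f := f) (t := B) (by intro z; simp)]
    refine Finset.sum_congr rfl fun h hh => ?_
    congr 1
    ext z
    simp only [Finset.mem_filter]
    constructor
    · tauto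
    · rintro ⟨h1, rfl⟩; tauto
  simp_rw [h1]
  have := tendsto_finsetSum B fun h _ => tendsto_card_fiber_div hA hne f hf h
  simpa [div_eq_mul_inv] using this

end Folner

/-! ### Boundary and divisibility counts in boxes. -/

section Counting

variable {d : ℕ}

/-- The integer points of the cube `[-L, L]^d`. -/
def box (d L : ℕ) : Finset (Fin d → ℤ) :=
  Fintype.piFinset fun _ => Finset.Icc (-(L : ℤ)) L

theorem mem_box {L : ℕ} {z : Fin d → ℤ} : z ∈ box d L ↔ ∀ i, |z i| ≤ L := by
  simp [box, abs_le]

theorem card_box (d L : ℕ) : (box d L).card = (2 * L + 1) ^ d := by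
  simp only [box, Fintype.card_piFinset, Int.card_Icc, Finset.prod_const, Finset.card_univ,
    Fintype.card_fin]
  congr 1
  omega

/-- On each line in direction `i` the set is an integer interval, so at most one of its points
exits; the other `d - 1` coordinates label the lines. -/
theorem card_filter_add_single_notMem_le {A : Finset (Fin d → ℤ)} {L : ℕ} (hL : A ⊆ box d L)
    (i : Fin d)
    (hconv : ∀ z ∈ A, ∀ w ∈ A, ∀ u : Fin d → ℤ, (∀ j ≠ i, z j = w j) → (∀ j ≠ i, u j = z j) →
      z i ≤ u i → u i ≤ w i → u ∈ A) :
    (A.filter fun z => z + Pi.single i 1 ∉ A).card ≤ (2 * L + 1) ^ (d - 1) := by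
  have hlt : ∀ z ∈ A, z + Pi.single i 1 ∉ A → ∀ w ∈ A, (∀ j ≠ i, z j = w j) → w i ≤ z i := by
    intro z hz hz' w hw hzw
    by_contra! hlt
    refine hz' (hconv z hz w hw _ hzw (fun j hj => by simp [hj]) (by simp) ?_)
    simp only [Pi.add_apply, Pi.single_eq_same]
    omega
  let T : Finset ({j // j ≠ i} → ℤ) := Fintype.piFinset fun _ => Finset.Icc (-(L : ℤ)) L
  have hT : T.card = (2 * L + 1) ^ (d - 1) := by
    simp only [T, Fintype.card_piFinset, Int.card_Icc, Finset.prod_const, Finset.card_univ,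
      Fintype.card_subtype_compl, Fintype.card_fin, Fintype.card_unique]
    congr 1
    omega
  rw [← hT]
  refine Finset.card_le_card_of_injOn (fun z j => z j) (fun z hz => ?_) ?_
  · have := mem_box.1 (hL (Finset.mem_filter.1 hz).1)
    simp only [T, Finset.mem_coe, Fintype.mem_piFinset, Finset.mem_Icc]
    exact fun j => abs_le.1 (this j)
  · intro z hz w hw hzw
    rw [Finset.mem_coe, Finset.mem_filter] at hz hw
    have h : ∀ j ≠ i, z j = w j := fun j hj => congrFun hzw ⟨j, hj⟩
    funext j
    by_cases hj : j = i
    · subst hj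
      exact le_antisymm (hlt w hw.1 hw.2 z hz.1 fun k hk => (h k hk).symm)
        (hlt z hz.1 hz.2 w hw.1 h)
    · exact h j hj

theorem dvd_gcdLabel_iff {k : ℕ} {z : Fin d → ℤ} : k ∣ gcdLabel d z ↔ ∀ i, (k : ℤ) ∣ z i := by
  simp [gcdLabel, Finset.dvd_gcd_iff, Int.natCast_dvd]

theorem gcdLabel_eq_zero_iff {z : Fin d → ℤ} : gcdLabel d z = 0 ↔ z = 0 := by
  simp [gcdLabel, Finset.gcd_eq_zero_iff, funext_iff]

theorem card_box_filter_dvd_le (L m : ℕ) (hm : 0 < m) :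
    ((box d L).filter fun z => m ∣ gcdLabel d z).card ≤ (2 * (L / m) + 1) ^ d := by
  rw [← card_box]
  have hm' : (m : ℤ) ≠ 0 := by exact_mod_cast hm.ne'
  refine Finset.card_le_card_of_injOn (fun z i => z i / m) (fun z hz => ?_) ?_
  · simp only [Finset.coe_filter, Set.mem_ofPred_eq, mem_box, dvd_gcdLabel_iff] at hz
    rw [Finset.mem_coe, mem_box]
    intro i
    obtain ⟨k, hk⟩ := hz.2 i
    have h1 := hz.1 i
    simp only [hk, Int.mul_ediv_cancel_left _ hm'] at h1 ⊢
    push_cast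
    rw [Int.le_ediv_iff_mul_le (by exact_mod_cast hm)]
    rwa [abs_mul, Nat.abs_cast, mul_comm] at h1
  · intro z hz w hw hzw
    simp only [Finset.coe_filter, Set.mem_ofPred_eq, dvd_gcdLabel_iff] at hz hw
    funext i
    have h : z i / (m : ℤ) = w i / m := congrFun hzw i
    rw [← Int.ediv_mul_cancel (hz.2 i), ← Int.ediv_mul_cancel (hw.2 i), h]

theorem gcdLabel_le_of_mem_box {L : ℕ} {z : Fin d → ℤ} (hz : z ∈ box d L) (h0 : z ≠ 0) :
    gcdLabel d z ≤ L := by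
  obtain ⟨i, hi⟩ := Function.ne_iff.1 h0
  have h1 := Int.le_of_dvd (abs_pos.2 hi)
    ((dvd_abs _ _).2 (dvd_gcdLabel_iff.1 (dvd_refl (gcdLabel d z)) i))
  exact_mod_cast h1.trans (mem_box.1 hz i)

/-- Union bound over the value `m` of the gcd, with `N < m ≤ L`. Each term is of order `(L / m) ^
d`, and `d ≥ 2` bounds the sum by the tail of `∑ m⁻²`. -/
theorem card_box_filter_lt_gcdLabel_le (hd : 2 ≤ d) (L N : ℕ) :
    (((box d L).filter fun z => N < gcdLabel d z).card : ℝ) ≤ (3 * L) ^ d * (2 / (N + 1)) := by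
  have h1 : (box d L).filter (fun z => N < gcdLabel d z) ⊆
      (Finset.Ioo N (L + 1)).biUnion fun m => (box d L).filter fun z => m ∣ gcdLabel d z := by
    intro z hz
    obtain ⟨hz, hN⟩ := Finset.mem_filter.1 hz
    simp only [Finset.mem_biUnion, Finset.mem_Ioo, Finset.mem_filter]
    refine ⟨_, ⟨hN, Nat.lt_succ_of_le (gcdLabel_le_of_mem_box hz fun h => ?_)⟩, hz, dvd_rfl⟩
    rw [gcdLabel_eq_zero_iff.2 h] at hN
    omega
  have h2 : ∀ m ∈ Finset.Ioo N (L + 1), (((box d L).filter fun z => m ∣ gcdLabel d z).card : ℝ) ≤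
      (3 * L) ^ d * ((m : ℝ) ^ 2)⁻¹ := by
    intro m hm
    rw [Finset.mem_Ioo] at hm
    have hm0 : 0 < m := by omega
    have hm1 : (1 : ℝ) ≤ m := by exact_mod_cast hm0
    -- The `+ 1` is absorbed because `m ≤ L`.
    have h3 : 2 * (L / m) + 1 ≤ 3 * (L / m) := by
      have : 1 ≤ L / m := (Nat.one_le_div_iff hm0).2 (by omega)
      omega
    calc (((box d L).filter fun z => m ∣ gcdLabel d z).card : ℝ)
        ≤ ((3 * (L / m : ℕ) : ℕ) : ℝ) ^ d := by
          exact_mod_cast (card_box_filter_dvd_le L m hm0).trans (Nat.pow_le_pow_left h3 d)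
      _ ≤ (3 * (L / m : ℝ)) ^ d := by
          push_cast
          gcongr
          exact Nat.cast_div_le
      _ = (3 * L) ^ d * ((m : ℝ) ^ d)⁻¹ := by
          rw [← mul_div_assoc, div_pow, div_eq_mul_inv]
      _ ≤ _ := by
          gcongr
  calc (((box d L).filter fun z => N < gcdLabel d z).card : ℝ)
      ≤ ∑ m ∈ Finset.Ioo N (L + 1), (((box d L).filter fun z => m ∣ gcdLabel d z).card : ℝ) := by
        exact_mod_cast (Finset.card_le_card h1).trans Finset.card_biUnion_le
    _ ≤ ∑ m ∈ Finset.Ioo N (L + 1), (3 * L) ^ d * ((m : ℝ) ^ 2)⁻¹ := Finset.sum_le_sum h2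
    _ ≤ _ := by
        rw [← Finset.mul_sum]
        gcongr
        exact sum_Ioo_inv_sq_le N (L + 1)

/-- Label zero occurs only at `z = -x`, whence the `+ 1`; the other bad points move by `x` into the
box of size `2 * L`. -/
theorem card_filter_gcdLabel_add_le (hd : 2 ≤ d) {A : Finset (Fin d → ℤ)} {L : ℕ}
    (hA : A ⊆ box d L) {x : Fin d → ℤ} (hx : x ∈ box d L) (N : ℕ) :
    ((A.filter fun z => gcdLabel d (x + z) = 0 ∨ N < gcdLabel d (x + z)).card : ℝ) ≤
      (6 * L) ^ d * (2 / (N + 1)) + 1 := by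
  classical
  have h1 : A.filter (fun z => gcdLabel d (x + z) = 0 ∨ N < gcdLabel d (x + z)) ⊆
      A.filter (fun z => N < gcdLabel d (x + z)) ∪ {-x} := by
    intro z
    simp only [Finset.mem_filter, Finset.mem_union, Finset.mem_singleton, gcdLabel_eq_zero_iff,
      add_eq_zero_iff_eq_neg']
    tauto
  have h2 : (A.filter fun z => N < gcdLabel d (x + z)).card ≤
      ((box d (2 * L)).filter fun z => N < gcdLabel d z).card := by
    refine Finset.card_le_card_of_injOn (x + ·) (fun z hz => ?_) (add_right_injective x).injOn
    simp only [Finset.coe_filter, Set.mem_ofPred_eq] at hz ⊢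
    refine ⟨mem_box.2 fun i => ?_, hz.2⟩
    have h3 := mem_box.1 hx i
    have h4 := mem_box.1 (hA hz.1) i
    have h5 := abs_add_le (x i) (z i)
    simp only [Pi.add_apply]
    push_cast
    omega
  have h3 := card_box_filter_lt_gcdLabel_le hd (2 * L) N
  have h4 : ((A.filter fun z => gcdLabel d (x + z) = 0 ∨ N < gcdLabel d (x + z)).card : ℝ) ≤
      ((box d (2 * L)).filter fun z => N < gcdLabel d z).card + 1 := by
    exact_mod_cast (Finset.card_le_card h1).trans ((Finset.card_union_le _ _).trans
      (by simpa using h2))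
  push_cast at h3
  rw [← mul_assoc] at h3
  norm_num at h3 ⊢
  linarith

end Counting

/-! ### Lattice points of dilated convex bodies. -/

section Convex

variable {d : ℕ} {F : Set (EuclideanSpace ℝ (Fin d))}

theorem exists_latticePoints_subset_box (hF : Bornology.IsBounded F) :
    ∃ K : ℝ, 0 < K ∧ ∀ r : ℝ, 0 < r → latticePoints F r ⊆ box d ⌊K * r⌋₊ := by
  obtain ⟨K, hK0, hK⟩ := hF.exists_pos_norm_le
  refine ⟨K, hK0, fun r hr z hz => ?_⟩
  rw [Finset.mem_coe, mem_box]
  intro i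
  have h1 := (PiLp.norm_apply_le _ i).trans (hK _ hz)
  simp only [PiLp.smul_apply, smul_eq_mul, norm_mul, norm_inv, Real.norm_eq_abs, abs_of_pos hr] at h1
  rw [inv_mul_le_iff₀ hr, mul_comm] at h1
  have h2 : (z i).natAbs ≤ ⌊K * r⌋₊ := by
    apply Nat.le_floor
    rwa [Nat.cast_natAbs, Int.cast_abs]
  rw [Int.abs_eq_natAbs]
  exact_mod_cast h2

theorem exists_pow_le_card_of_latticePoints_subset (hF : (interior F).Nonempty) :
    ∃ c : ℝ, 0 < c ∧ ∀ᶠ r : ℝ in atTop, ∀ A : Finset (Fin d → ℤ), latticePoints F r ⊆ A →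
      (c * r) ^ d ≤ A.card := by
  obtain ⟨a, ha⟩ := hF
  -- Pulling back to the sup metric turns balls into cubes, whose lattice points are counted
  -- coordinatewise.
  have hopen : IsOpen ((WithLp.toLp 2 : (Fin d → ℝ) → EuclideanSpace ℝ (Fin d)) ⁻¹' interior F) :=
    isOpen_interior.preimage (PiLp.continuous_toLp 2 _)
  obtain ⟨ε, hε, hball⟩ := Metric.isOpen_iff.1 hopen (WithLp.ofLp a) (by simpa using ha)
  set δ := ε / 2 with hδ
  have hδ0 : 0 < δ := by positivity
  set b : Fin d → ℝ := WithLp.ofLp a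
  refine ⟨δ, hδ0, ?_⟩
  filter_upwards [eventually_ge_atTop (1 / δ), eventually_gt_atTop 0] with r hr hr0 A hA
  rw [div_le_iff₀ hδ0] at hr
  have hsub : (Fintype.piFinset fun i => Finset.Icc ⌈r * (b i - δ)⌉ ⌊r * (b i + δ)⌋) ⊆ A := by
    intro z hz
    refine hA (interior_subset (a := r⁻¹ • WithLp.toLp 2 fun i => (z i : ℝ)) ?_)
    have : (fun i => r⁻¹ * (z i : ℝ)) ∈ Metric.ball b ε := by
      rw [Metric.mem_ball]
      refine lt_of_le_of_lt ((dist_pi_le_iff hδ0.le).2 fun i => ?_) (half_lt_self hε)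
      simp only [Fintype.mem_piFinset, Finset.mem_Icc, Int.ceil_le, Int.le_floor] at hz
      rw [Real.dist_eq, abs_le, neg_le_sub_iff_le_add, sub_le_iff_le_add]
      have h1 := (hz i).1
      have h2 := (hz i).2
      rw [← le_inv_mul_iff₀ hr0] at h1
      rw [← inv_mul_le_iff₀ hr0] at h2
      constructor <;> linarith
    exact hball this
  calc (δ * r) ^ d = ∏ i : Fin d, (δ * r) := by simp
    _ ≤ ∏ i : Fin d, ((Finset.Icc ⌈r * (b i - δ)⌉ ⌊r * (b i + δ)⌋).card : ℝ) := by
        refine Finset.prod_le_prod (fun _ _ => by positivity) fun i _ => ?_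
        have h1 := Int.ceil_lt_add_one (r * (b i - δ))
        have h2 := Int.sub_one_lt_floor (r * (b i + δ))
        have h3 : (⌊r * (b i + δ)⌋ : ℝ) + 1 - ⌈r * (b i - δ)⌉ ≤
            (Finset.Icc ⌈r * (b i - δ)⌉ ⌊r * (b i + δ)⌋).card := by
          rw [Int.card_Icc]
          exact_mod_cast Int.self_le_toNat _
        -- Each side has more than `2 * δ * r - 1` integers, which is at least `δ * r` as `δ * r ≥
        -- 1`.
        nlinarith
    _ = ((Fintype.piFinset fun i => Finset.Icc ⌈r * (b i - δ)⌉ ⌊r * (b i + δ)⌋).card : ℝ) := by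
        simp [Fintype.card_piFinset]
    _ ≤ A.card := by exact_mod_cast Finset.card_le_card hsub

theorem latticePoints_mem_of_between (hF : Convex ℝ F) (r : ℝ) (i : Fin d) {z w u : Fin d → ℤ}
    (hz : z ∈ latticePoints F r) (hw : w ∈ latticePoints F r) (hzw : ∀ j ≠ i, z j = w j)
    (hu : ∀ j ≠ i, u j = z j) (h1 : z i ≤ u i) (h2 : u i ≤ w i) : u ∈ latticePoints F r := by
  rcases h1.eq_or_lt with h1 | h1
  · have : u = z := by
      funext j
      by_cases hj : j = i
      · rw [hj, h1]
      · exact hu j hj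
    rwa [this]
  have h1' : (z i : ℝ) < u i := by exact_mod_cast h1
  have h2' : (u i : ℝ) ≤ w i := by exact_mod_cast h2
  have h3 : (0 : ℝ) < w i - z i := by linarith
  set t : ℝ := (u i - z i) / (w i - z i) with ht
  have ht0 : 0 ≤ t := div_nonneg (by linarith) h3.le
  have ht1 : t ≤ 1 := (div_le_one h3).2 (by linarith)
  have := hF hz hw (sub_nonneg.2 ht1) ht0 (by ring)
  unfold latticePoints
  rw [Set.mem_ofPred_eq]
  convert this using 1
  ext j
  simp only [PiLp.smul_apply, PiLp.add_apply, smul_eq_mul]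
  by_cases hj : j = i
  · subst hj
    have : t * (w j - z j) = u j - z j := div_mul_cancel₀ _ h3.ne'
    linear_combination (-r⁻¹) * this
  · rw [hu j hj, ← hzw j hj]
    ring

variable {A : ℝ → Finset (Fin d → ℤ)}

theorem tendsto_card_atTop (hd : d ≠ 0) (hFi : (interior F).Nonempty)
    (hA : ∀ r, 0 < r → (A r : Set (Fin d → ℤ)) = latticePoints F r) :
    Tendsto (fun r => ((A r).card : ℝ)) atTop atTop := by
  obtain ⟨c, hc, h⟩ := exists_pow_le_card_of_latticePoints_subset hFi
  refine tendsto_atTop_mono' _ ?_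
    ((tendsto_pow_atTop hd).comp (tendsto_id.const_mul_atTop hc))
  filter_upwards [h, eventually_gt_atTop 0] with r hr hr0
  exact hr _ (hA r hr0).ge

/-- Boundary of order `r ^ (d - 1)` against volume of order `r ^ d`. Unit vectors suffice, since the
good translations form a subgroup. -/
theorem tendsto_shiftLoss_latticePoints (hFb : Bornology.IsBounded F)
    (hFc : Convex ℝ F) (hFi : (interior F).Nonempty)
    (hA : ∀ r, 0 < r → (A r : Set (Fin d → ℤ)) = latticePoints F r) (v : Fin d → ℤ) :
    Tendsto (fun r => shiftLoss (A r) v) atTop (𝓝 0) := by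
  obtain ⟨c, hc, hlow⟩ := exists_pow_le_card_of_latticePoints_subset hFi
  obtain ⟨K, hK, hup⟩ := exists_latticePoints_subset_box hFb
  have hsingle : ∀ i, Pi.single i 1 ∈ asymptoticStabilizer atTop A := by
    intro i
    have hlim : Tendsto (fun r : ℝ => (3 * K) ^ (d - 1) / c ^ d * r⁻¹) atTop (𝓝 0) := by
      simpa using tendsto_inv_atTop_zero.const_mul ((3 * K) ^ (d - 1) / c ^ d)
    refine squeeze_zero' (Eventually.of_forall fun r => shiftLoss_nonneg _ _) ?_ hlim
    filter_upwards [hlow, eventually_gt_atTop 0, eventually_ge_atTop (1 / K)] with r hr hr0 hrK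
    rw [div_le_iff₀ hK] at hrK
    have hAr := hA r hr0
    have hmem : ∀ {z}, z ∈ A r ↔ z ∈ latticePoints F r := fun {z} => by
      rw [← hAr, Finset.mem_coe]
    have h1 := card_filter_add_single_notMem_le (A := A r) (L := ⌊K * r⌋₊)
      (by rw [← Finset.coe_subset, hAr]; exact hup r hr0) i
      (fun z hz w hw u h1 h2 h3 h4 => hmem.2
        (latticePoints_mem_of_between hFc r i (hmem.1 hz) (hmem.1 hw) h1 h2 h3 h4))
    have h2 : (((A r).filter fun z => z + Pi.single i 1 ∉ A r).card : ℝ) ≤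
        (3 * K * r) ^ (d - 1) := by
      have h3 : (2 * (⌊K * r⌋₊ : ℝ) + 1) ≤ 3 * K * r := by
        have := Nat.floor_le (a := K * r) (by positivity)
        linarith
      calc _ ≤ (2 * (⌊K * r⌋₊ : ℝ) + 1) ^ (d - 1) := by exact_mod_cast h1
        _ ≤ _ := by gcongr
    have h4 : r ^ d = r ^ (d - 1) * r := by
      rw [← pow_succ, Nat.sub_add_cancel (Fin.pos i)]
    calc shiftLoss (A r) (Pi.single i 1) ≤ (3 * K * r) ^ (d - 1) / (c * r) ^ d := by
          unfold shiftLoss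
          have := hr _ hAr.ge
          gcongr
      _ = (3 * K) ^ (d - 1) / c ^ d * r⁻¹ := by
          rw [mul_pow _ r, mul_pow c, h4]
          field_simp
  have hv : v ∈ asymptoticStabilizer atTop A := by
    have : v = ∑ i, v i • (Pi.single i 1 : Fin d → ℤ) := by
      funext j
      simp [Finset.sum_apply, Pi.single_apply]
    rw [this]
    exact sum_mem fun i _ => zsmul_mem (hsingle i) _
  exact hv

/-- The constant precedes `x` and `N`, so that `N` can be fixed before `r` grows. The single zero
label costs `1 / (A r).card`, eventually at most `1 / (N + 1)`. -/
theorem exists_card_filter_gcdLabel_div_le (hd : 2 ≤ d) (hFb : Bornology.IsBounded F)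
    (hFi : (interior F).Nonempty)
    (hA : ∀ r, 0 < r → (A r : Set (Fin d → ℤ)) = latticePoints F r) :
    ∃ C : ℝ, ∀ (x : Fin d → ℤ) (N : ℕ), ∀ᶠ r in atTop,
      (((A r).filter fun z => gcdLabel d (x + z) = 0 ∨ N < gcdLabel d (x + z)).card : ℝ) /
        (A r).card ≤ C / (N + 1) := by
  obtain ⟨c, hc, hlow⟩ := exists_pow_le_card_of_latticePoints_subset hFi
  obtain ⟨K, hK, hup⟩ := exists_latticePoints_subset_box hFb
  refine ⟨(6 * K / c) ^ d * 2 + 1, fun x N => ?_⟩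
  have hbox : ∀ᶠ r : ℝ in atTop, x ∈ box d ⌊K * r⌋₊ := by
    have h1 : ∀ i, ∀ᶠ r : ℝ in atTop, (x i).natAbs ≤ ⌊K * r⌋₊ := fun i =>
      (tendsto_nat_floor_atTop.comp (tendsto_id.const_mul_atTop hK)).eventually_ge_atTop _
    filter_upwards [eventually_all.2 h1] with r hr
    refine mem_box.2 fun i => ?_
    rw [Int.abs_eq_natAbs]
    exact_mod_cast hr i
  filter_upwards [hlow, hbox, eventually_gt_atTop 0,
    (tendsto_card_atTop (by omega) hFi hA).eventually_ge_atTop ((N : ℝ) + 1)] with r hr hx hr0 hN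
  have hAr := hA r hr0
  have h1 := card_filter_gcdLabel_add_le hd (A := A r) (L := ⌊K * r⌋₊)
    (by rw [← Finset.coe_subset, hAr]; exact hup r hr0) hx N
  have h2 := hr _ hAr.ge
  have h3 : 0 < (c * r) ^ d := by positivity
  have h4 := Nat.floor_le (a := K * r) (by positivity)
  have h5 : (1 : ℝ) / (A r).card ≤ 1 / (N + 1) := by gcongr
  calc _ ≤ ((6 * (⌊K * r⌋₊ : ℝ)) ^ d * (2 / (N + 1)) + 1) / (A r).card := by gcongr
    _ = (6 * (⌊K * r⌋₊ : ℝ)) ^ d * (2 / (N + 1)) / (A r).card + 1 / (A r).card := add_div _ _ _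
    _ ≤ (6 * (K * r)) ^ d * (2 / (N + 1)) / (c * r) ^ d + 1 / (N + 1) := by gcongr
    _ = ((6 * K / c) ^ d * 2 + 1) / (N + 1) := by
        rw [← mul_assoc, mul_pow _ r, mul_pow c, div_pow]
        field_simp

end Convex

/-! ### The chain of cosets for one prime. -/

section Chain

variable {d p : ℕ}

/-- The coset of `p^n ℤ^d` containing a coset of `p^(n+1) ℤ^d`, on the level of indices. -/
def reduce (d p n : ℕ) : CosetIndex d p (n + 1) →+ CosetIndex d p n where
  toFun c i := ZMod.castHom (pow_dvd_pow p n.le_succ) (ZMod (p ^ n)) (c i)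
  map_zero' := by funext i; simp
  map_add' := fun a b => by funext i; simp only [Pi.add_apply, map_add]

theorem reduce_surjective (n : ℕ) : Function.Surjective (reduce d p n) := by
  intro c
  choose y hy using fun i => ZMod.intCast_surjective (c i)
  exact ⟨fun i => (y i : ZMod (p ^ (n + 1))), funext fun i =>
    (map_intCast (ZMod.castHom (pow_dvd_pow p n.le_succ) (ZMod (p ^ n))) (y i)).trans (hy i)⟩

theorem mem_subcosets_iff {n : ℕ} {c : CosetIndex d p n} {c' : CosetIndex d p (n + 1)} :
    c' ∈ subcosets c ↔ reduce d p n c' = c := by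
  have key : ∀ x : Fin d → ℤ, x ∈ cosetSet c' →
      ∀ i, ((x i : ℤ) : ZMod (p ^ n)) = reduce d p n c' i := by
    intro x hx i
    exact (map_intCast (ZMod.castHom (pow_dvd_pow p n.le_succ) (ZMod (p ^ n))) (x i)).symm.trans
      (congrArg _ (hx i))
  constructor
  · intro h
    choose y hy using fun i => ZMod.intCast_surjective (c' i)
    funext i
    rw [← key y hy i]
    exact h hy i
  · rintro rfl x hx i
    exact key x hx i

theorem card_fiber_mul_card {G H : Type*} [AddCommGroup G] [AddCommGroup H] [Fintype G] [Fintype H]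
    [DecidableEq H] (f : G →+ H) (hf : Function.Surjective f) (h : H) :
    (Finset.univ.filter fun g => f g = h).card * Fintype.card H = Fintype.card G := by
  have h1 : ∀ h', (Finset.univ.filter fun g => f g = h').card =
      (Finset.univ.filter fun g => f g = h).card := fun h' =>
    AddMonoidHom.card_fiber_eq_of_mem_range f (hf h') (hf h)
  have h2 := Finset.card_eq_sum_card_fiberwise (f := f) (s := Finset.univ) (t := Finset.univ)
    (fun _ _ => Finset.mem_coe.2 (Finset.mem_univ _))
  rw [Finset.sum_congr rfl fun h' _ => h1 h'] at h2
  simpa [mul_comm] using h2.symm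

variable [NeZero p]

theorem card_subcosets {n : ℕ} (c : CosetIndex d p n) : (subcosets c).ncard = p ^ d := by
  classical
  have h1 : subcosets c = (Finset.univ.filter fun c' => reduce d p n c' = c : Finset _) := by
    ext c'
    simp [mem_subcosets_iff]
  rw [h1, Set.ncard_coe_finset]
  have h2 := card_fiber_mul_card (reduce d p n) (reduce_surjective n) c
  simp only [Fintype.card_pi, ZMod.card, Finset.prod_const, Finset.card_univ,
    Fintype.card_fin] at h2
  have h3 : (p ^ (n + 1)) ^ d = (p ^ n) ^ d * p ^ d := by rw [pow_succ, mul_pow]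
  rw [mul_comm] at h2
  replace h2 := h2.trans h3
  exact Nat.eq_of_mul_eq_mul_left (pow_pos (pow_pos (NeZero.pos p) n) d) h2

theorem uniformOn_subcosets_singleton {n : ℕ} (c : CosetIndex d p n)
    (c' : CosetIndex d p (n + 1)) :
    uniformOn (subcosets c) {c'} =
      Set.indicator {reduce d p n c'} (fun _ => ((p : ℝ≥0∞) ^ d)⁻¹) c := by
  rw [uniformOn, cond_apply (Set.toFinite _).measurableSet,
    Measure.count_apply_finite _ (Set.toFinite _), ← Set.ncard_eq_toFinset_card _ (Set.toFinite _),
    card_subcosets]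
  by_cases h : c' ∈ subcosets c
  · have h' : c ∈ ({reduce d p n c'} : Set _) := (mem_subcosets_iff.1 h).symm
    rw [Set.inter_eq_right.2 (Set.singleton_subset_iff.2 h), Set.indicator_of_mem h']
    simp
  · have h' : c ∉ ({reduce d p n c'} : Set _) := fun h' =>
      h (mem_subcosets_iff.2 (Set.mem_singleton_iff.1 h').symm)
    rw [Set.inter_singleton_eq_empty.2 h, Set.indicator_of_notMem h']
    simp

/-- One-step disintegration of the trajectory measure, specialised to events in two consecutive
levels. -/
theorem chainLaw_succ_apply (n : ℕ) (s : Set (CosetIndex d p n × CosetIndex d p (n + 1))) :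
    chainLaw d p {W | (W n, W (n + 1)) ∈ s} =
      ∫⁻ W, uniformOn (subcosets (W n)) {c | (W n, c) ∈ s} ∂chainLaw d p := by
  have hs : MeasurableSet {q : ((i : Finset.Iic n) → CosetIndex d p i) × CosetIndex d p (n + 1) |
      (q.1 ⟨n, Finset.mem_Iic.2 le_rfl⟩, q.2) ∈ s} := MeasurableSet.of_discrete
  have h := congrArg (fun m => m {q | (q.1 ⟨n, Finset.mem_Iic.2 le_rfl⟩, q.2) ∈ s})
    (Kernel.map_frestrictLe_trajMeasure_compProd_eq_map_trajMeasure (κ := cosetStep d p)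
      (μ₀ := Measure.dirac (0 : CosetIndex d p 0)) (a := n))
  simp only at h
  rw [Measure.compProd_apply hs, lintegral_map (by fun_prop) (by fun_prop),
    Measure.map_apply (by fun_prop) hs] at h
  exact h.symm

/-- By induction: an index has a single parent, and is drawn from it with probability `p ^ (-d)`. -/
theorem chainLaw_apply_eq (n : ℕ) (c : CosetIndex d p n) :
    chainLaw d p {W | W n = c} = (((p ^ n : ℕ) : ℝ≥0∞) ^ d)⁻¹ := by
  induction n with
  | zero =>
    have : {W : (n : ℕ) → CosetIndex d p n | W 0 = c} = Set.univ := by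
      have : Subsingleton (CosetIndex d p 0) :=
        inferInstanceAs (Subsingleton (Fin d → ZMod 1))
      exact Set.eq_univ_of_forall fun W => Subsingleton.elim _ _
    rw [this, measure_univ]
    simp
  | succ n ih =>
    have h := chainLaw_succ_apply (d := d) (p := p) n {q | q.2 = c}
    simp only [Set.mem_ofPred_eq, Set.ofPred_eq_eq_singleton, uniformOn_subcosets_singleton] at h
    rw [h]
    have h2 : ∀ W : (n : ℕ) → CosetIndex d p n,
        Set.indicator {reduce d p n c} (fun _ => ((p : ℝ≥0∞) ^ d)⁻¹) (W n) =
        Set.indicator {W | W n = reduce d p n c} (fun _ => ((p : ℝ≥0∞) ^ d)⁻¹) W := by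
      intro W
      simp [Set.indicator]
    simp only [h2]
    rw [lintegral_indicator_const, ih]
    · push_cast
      rw [pow_succ, mul_pow, ENNReal.mul_inv (by simp) (by simp), mul_comm]
    · exact measurableSet_eq_fun (by fun_prop) (by fun_prop)

theorem ae_chainLaw_reduce_eq : ∀ᵐ W ∂chainLaw d p, ∀ n, reduce d p n (W (n + 1)) = W n := by
  rw [ae_all_iff]
  intro n
  have h := chainLaw_succ_apply (d := d) (p := p) n {q | ¬ reduce d p n q.2 = q.1}
  rw [ae_iff]
  refine h.trans ((lintegral_congr fun W => ?_).trans lintegral_zero)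
  rw [uniformOn_eq_zero_iff (Set.toFinite _)]
  ext c'
  simp [mem_subcosets_iff]

end Chain

/-! ### All primes together: nestedness and Borel–Cantelli. -/

section Chains

variable {d : ℕ}

instance : IsProbabilityMeasure (chainsLaw d) := by
  unfold chainsLaw; infer_instance

theorem measurePreserving_eval_chainsLaw (p : Nat.Primes) :
    MeasurePreserving (fun W : Chains d => W p) (chainsLaw d) (chainLaw d p) :=
  measurePreserving_eval_infinitePi (fun p : Nat.Primes => chainLaw d p) p

/-- The collection of chains is nested: the coset of level `n + 1` lies inside that of level `n`. -/
def IsNested (W : Chains d) : Prop :=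
  ∀ (p : Nat.Primes) (n : ℕ), reduce d p n (W p (n + 1)) = W p n

theorem ae_isNested : ∀ᵐ W ∂chainsLaw d, IsNested W := by
  unfold IsNested
  rw [ae_all_iff]
  exact fun p => (measurePreserving_eval_chainsLaw p).quasiMeasurePreserving.ae
    ae_chainLaw_reduce_eq

theorem IsNested.castHom_eq {W : Chains d} (hW : IsNested W) (p : Nat.Primes) {k n : ℕ}
    (h : k ≤ n) (i : Fin d) :
    ZMod.castHom (pow_dvd_pow (p : ℕ) h) (ZMod ((p : ℕ) ^ k)) (W p n i) = W p k i := by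
  induction n, h using Nat.le_induction with
  | base => simp
  | succ n h ih =>
    rw [← ih, ← hW p n]
    exact (RingHom.congr_fun (Subsingleton.elim _ ((ZMod.castHom (pow_dvd_pow (p : ℕ) h) _).comp
      (ZMod.castHom (pow_dvd_pow (p : ℕ) n.le_succ) _))) _)

theorem IsNested.mem_cosetSet_of_le {W : Chains d} (hW : IsNested W) {p : Nat.Primes} {k n : ℕ}
    (h : k ≤ n) {x : Fin d → ℤ} (hx : x ∈ cosetSet (W p n)) : x ∈ cosetSet (W p k) := by
  intro i
  rw [← hW.castHom_eq p h i, ← hx i, map_intCast]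

theorem chainsLaw_mem_cosetSet (p : Nat.Primes) (n : ℕ) (x : Fin d → ℤ) :
    chainsLaw d {W | x ∈ cosetSet (W p n)} = ((((p : ℕ) ^ n : ℕ) : ℝ≥0∞) ^ d)⁻¹ := by
  have h1 : {W : Chains d | x ∈ cosetSet (W p n)} =
      (fun W : Chains d => W p) ⁻¹' {V | V n = fun i => ((x i : ℤ) : ZMod ((p : ℕ) ^ n))} := by
    ext W
    simp [cosetSet, funext_iff, eq_comm]
  rw [h1, (measurePreserving_eval_chainsLaw p).measure_preimage
    (measurableSet_eq_fun (by fun_prop) (by fun_prop)).nullMeasurableSet, chainLaw_apply_eq]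

/-- Borel–Cantelli: distinct pairs give distinct prime powers, so the probabilities sum to at most
`∑ k⁻ᵈ < ∞`. Level zero, which always contains `x`, is skipped by the shift `q.2 + 1`. -/
theorem ae_finite_setOf_mem_cosetSet (hd : 2 ≤ d) (x : Fin d → ℤ) :
    ∀ᵐ W ∂chainsLaw d, {q : Nat.Primes × ℕ | x ∈ cosetSet (W q.1 (q.2 + 1))}.Finite := by
  refine ae_finite_setOfPred_mem (s := fun q : Nat.Primes × ℕ =>
    {W : Chains d | x ∈ cosetSet (W q.1 (q.2 + 1))}) ?_
  simp only [chainsLaw_mem_cosetSet]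
  have hinj : Function.Injective fun q : Nat.Primes × ℕ => (q.1 : ℕ) ^ (q.2 + 1) := by
    intro a b hab
    exact Nat.Primes.prodNatEquiv.injective (Subtype.ext hab)
  have hsum : Summable fun q : Nat.Primes × ℕ => ((((q.1 : ℕ) ^ (q.2 + 1) : ℕ) : ℝ) ^ d)⁻¹ :=
    (Real.summable_nat_pow_inv.2 hd).comp_injective hinj
  have hterm : ∀ q : Nat.Primes × ℕ, ((((q.1 : ℕ) ^ (q.2 + 1) : ℕ) : ℝ≥0∞) ^ d)⁻¹ =
      ENNReal.ofReal ((((q.1 : ℕ) ^ (q.2 + 1) : ℕ) : ℝ) ^ d)⁻¹ := by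
    intro q
    have : 0 < (q.1 : ℕ) ^ (q.2 + 1) := pow_pos q.1.2.pos _
    rw [ENNReal.ofReal_inv_of_pos (by positivity), ENNReal.ofReal_pow (by positivity),
      ENNReal.ofReal_natCast]
  simp only [hterm]
  exact hsum.tsum_ofReal_ne_top

end Chains

/-! ### Almost sure finiteness and measurability of the profile. -/

section Profile

variable {d : ℕ}

theorem prime_pow_dvd_prod_pow_iff (T : Finset Nat.Primes) (v : Nat.Primes → ℕ) (p : Nat.Primes)
    (n : ℕ) : (p : ℕ) ^ n ∣ ∏ q ∈ T, (q : ℕ) ^ v q ↔ n = 0 ∨ (p ∈ T ∧ n ≤ v p) := by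
  rcases Nat.eq_zero_or_pos n with rfl | hn
  · simp
  have hcop : ∀ S : Finset Nat.Primes, p ∉ S →
      Nat.Coprime ((p : ℕ) ^ n) (∏ q ∈ S, (q : ℕ) ^ v q) := fun S hS =>
    Nat.Coprime.prod_right fun q hq => Nat.Coprime.pow _ _ <|
      (Nat.coprime_primes p.2 q.2).2 fun h => hS (by rwa [Subtype.ext h])
  by_cases hp : p ∈ T
  · rw [← Finset.mul_prod_erase T _ hp, (hcop _ (Finset.notMem_erase p T)).dvd_mul_right,
      Nat.pow_dvd_pow_iff_le_right p.2.one_lt]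
    simp [hp, hn.ne']
  · simp only [hn.ne', hp, false_and, or_false, iff_false]
    intro h
    have := Nat.Coprime.eq_one_of_dvd (hcop T hp) h
    exact absurd this (Nat.one_lt_pow hn.ne' p.2.one_lt).ne'

theorem mem_cosetSet_zero (W : Chains d) (p : Nat.Primes) (x : Fin d → ℤ) :
    x ∈ cosetSet (W p 0) := by
  have : Subsingleton (ZMod ((p : ℕ) ^ 0)) := inferInstanceAs (Subsingleton (ZMod 1))
  exact fun i => Subsingleton.elim _ _

/-- Finiteness makes every valuation finite and all but finitely many zero, so the supremum of
partial products is attained on the finite set `T` of primes that occur. -/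
theorem exists_gcdProfile_eq {W : Chains d} (hW : IsNested W) {x : Fin d → ℤ}
    (hfin : {q : Nat.Primes × ℕ | x ∈ cosetSet (W q.1 (q.2 + 1))}.Finite) :
    ∃ g : ℕ, 0 < g ∧ gcdProfile W x = g ∧
      ∀ (p : Nat.Primes) (n : ℕ), (p : ℕ) ^ n ∣ g ↔ x ∈ cosetSet (W p n) := by
  have hv : ∀ p : Nat.Primes, ∃ v : ℕ, ∀ n, x ∈ cosetSet (W p n) ↔ n ≤ v := by
    intro p
    have h1 : ∃ n, x ∉ cosetSet (W p n) := by
      by_contra! h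
      have : Function.Injective fun n : ℕ => (p, n) := Prod.mk_right_injective p
      refine Set.infinite_of_injective_forall_mem this (fun n => ?_) hfin
      exact h (n + 1)
    classical
    refine ⟨Nat.find h1 - 1, fun n => ⟨fun hn => ?_, fun hn => ?_⟩⟩
    · by_contra! hlt
      exact Nat.find_spec h1 (hW.mem_cosetSet_of_le (by omega) hn)
    · rcases Nat.eq_zero_or_pos n with rfl | hn0
      · exact mem_cosetSet_zero W p x
      · exact not_not.1 (Nat.find_min h1 (m := n) (by omega))
  choose v hv using hv
  have hval : ∀ p, valuation W p x = v p := by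
    intro p
    refine le_antisymm (iSup_le fun n => ?_) ?_
    · exact_mod_cast (hv p n).1 n.2
    · exact le_iSup (fun n : {n : ℕ // x ∈ cosetSet (W p n)} => ((n : ℕ) : ℕ∞))
        ⟨v p, (hv p _).2 le_rfl⟩
  classical
  set T : Finset Nat.Primes := hfin.toFinset.image Prod.fst
  have hT : ∀ p, p ∉ T → v p = 0 := by
    intro p hp
    by_contra h
    refine hp (Finset.mem_image.2 ⟨(p, 0), ?_, rfl⟩)
    rw [Set.Finite.mem_toFinset]
    exact (hv p 1).2 (Nat.one_le_iff_ne_zero.2 h)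
  refine ⟨∏ q ∈ T, (q : ℕ) ^ v q, Finset.prod_pos fun q _ => pow_pos q.2.pos _, ?_, fun p n => ?_⟩
  · have h2 : ¬ ∀ p, valuation W p x = ⊤ := fun h =>
      ENat.natCast_ne_top (v ⟨2, Nat.prime_two⟩) ((hval _).symm.trans (h _))
    have h3 : ∀ S : Finset Nat.Primes, ∏ p ∈ S, extPow p (valuation W p x) =
        ((∏ p ∈ S, (p : ℕ) ^ v p : ℕ) : ℕ∞) := by
      intro S
      rw [Nat.cast_prod]
      refine Finset.prod_congr rfl fun p _ => ?_
      rw [hval]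
      rfl
    rw [gcdProfile, if_neg h2]
    simp only [h3]
    refine le_antisymm (iSup_le fun S => ?_) (le_iSup_of_le T le_rfl)
    have h4 : ∏ p ∈ T, (p : ℕ) ^ v p = ∏ p ∈ T ∪ S, (p : ℕ) ^ v p :=
      Finset.prod_subset Finset.subset_union_left fun p _ hp => by rw [hT p hp, pow_zero]
    rw [h4]
    exact_mod_cast Finset.prod_le_prod_of_subset_of_one_le' Finset.subset_union_right
      fun (p : Nat.Primes) _ _ => Nat.one_le_pow _ _ p.2.pos
  · rw [prime_pow_dvd_prod_pow_iff, hv]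
    by_cases hp : p ∈ T
    · simp only [hp, true_and]
      omega
    · simp only [hp, false_and, or_false, hT p hp]
      omega

theorem borelSpace_of_countable (α : Type*) [TopologicalSpace α] [T1Space α] [Countable α]
    [MeasurableSpace α] [DiscreteMeasurableSpace α] : BorelSpace α := by
  refine ⟨le_antisymm (fun s _ => ?_) fun s _ => MeasurableSet.of_discrete⟩
  let := borel α
  have : BorelSpace α := ⟨rfl⟩
  exact (Set.to_countable s).measurableSet

instance : BorelSpace ℕ∞ := borelSpace_of_countable ℕ∞

theorem measurable_valuation (p : Nat.Primes) (x : Fin d → ℤ) :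
    Measurable fun W : Chains d => valuation W p x := by
  -- The index type of the supremum depends on `W`; indicators replace it by a fixed countable one.
  have h1 : (fun W : Chains d => valuation W p x) =
      fun W => ⨆ n : ℕ, Set.indicator {W | x ∈ cosetSet (W p n)} (fun _ => (n : ℕ∞)) W := by
    funext W
    unfold valuation
    refine le_antisymm (iSup_le fun n => ?_) (iSup_le fun n => ?_)
    · refine le_iSup_of_le n.1 ?_
      rw [Set.indicator_of_mem (show W ∈ {W | x ∈ cosetSet (W p n)} from n.2)]
    · by_cases hn : x ∈ cosetSet (W p n)
      · rw [Set.indicator_of_mem (show W ∈ {W | x ∈ cosetSet (W p n)} from hn)]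
        exact le_iSup (fun n : {n : ℕ // x ∈ cosetSet (W p n)} => ((n : ℕ) : ℕ∞)) ⟨n, hn⟩
      · rw [Set.indicator_of_notMem (show W ∉ {W | x ∈ cosetSet (W p n)} from hn)]
        exact zero_le
  rw [h1]
  refine Measurable.iSup fun n => measurable_const.indicator ?_
  have : Measurable fun W : Chains d => W p n := by fun_prop
  exact this (MeasurableSet.of_discrete (s := {c | x ∈ cosetSet c}))

theorem measurable_gcdProfile : Measurable (gcdProfile (d := d)) := by
  classical
  rw [measurable_pi_iff]
  intro x
  unfold gcdProfile
  refine Measurable.ite ?_ measurable_const (Measurable.iSup fun S => ?_)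
  · rw [Set.ofPred_forall]
    exact MeasurableSet.iInter fun p => measurable_valuation p x (measurableSet_singleton _)
  · exact Finset.measurable_fun_prod S fun p _ =>
      (Measurable.of_discrete (f := extPow p)).comp (measurable_valuation p x)

/-- The random gcd profile with values in `ℕ`. -/
def natProfile (W : Chains d) (x : Fin d → ℤ) : ℕ := (gcdProfile W x).toNat

theorem measurable_natProfile : Measurable (natProfile (d := d)) := by
  rw [measurable_pi_iff]
  exact fun x => (Measurable.of_discrete (f := ENat.toNat)).comp
    (measurable_pi_iff.1 measurable_gcdProfile x)

/-- Almost sure description of the random gcd profile by its prime power divisors. -/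
def IsRegular (W : Chains d) : Prop :=
  IsNested W ∧ ∀ x, 0 < natProfile W x ∧ gcdProfile W x = natProfile W x ∧
    ∀ (p : Nat.Primes) (n : ℕ), (p : ℕ) ^ n ∣ natProfile W x ↔ x ∈ cosetSet (W p n)

theorem ae_isRegular (hd : 2 ≤ d) : ∀ᵐ W ∂chainsLaw d, IsRegular W := by
  have h1 := (ae_all_iff (μ := chainsLaw d)).2 (ae_finite_setOf_mem_cosetSet hd)
  filter_upwards [ae_isNested, h1] with W hW hfin
  refine ⟨hW, fun x => ?_⟩
  obtain ⟨g, hg0, hg, hdvd⟩ := exists_gcdProfile_eq hW (hfin x)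
  have : natProfile W x = g := by rw [natProfile, hg, ENat.toNat_natCast]
  rw [this]
  exact ⟨hg0, hg, hdvd⟩

end Profile

/-! ### Truncation by a modulus and the Chinese remainder theorem. -/

section Truncation

variable {d : ℕ}

/-- The primes at most `N`. -/
def primesUpTo (N : ℕ) : Finset Nat.Primes := Finset.subtype Nat.Prime (Finset.range (N + 1))

theorem mem_primesUpTo {N : ℕ} {p : Nat.Primes} : p ∈ primesUpTo N ↔ (p : ℕ) ≤ N := by
  exact Finset.mem_subtype.trans (Finset.mem_range.trans Nat.lt_succ_iff)

/-- A modulus divisible by all the positive integers up to `N`. -/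
def modulus (N : ℕ) : ℕ := ∏ p : primesUpTo N, ((p : Nat.Primes) : ℕ) ^ N

theorem prime_pow_dvd_modulus_iff {N n : ℕ} {p : Nat.Primes} :
    (p : ℕ) ^ n ∣ modulus N ↔ n = 0 ∨ ((p : ℕ) ≤ N ∧ n ≤ N) := by
  rw [modulus, Finset.prod_coe_sort (primesUpTo N) fun p : Nat.Primes => (p : ℕ) ^ N,
    prime_pow_dvd_prod_pow_iff _ fun _ => N, mem_primesUpTo]

instance (N : ℕ) : NeZero (modulus N) :=
  ⟨Finset.prod_ne_zero_iff.2 fun p _ => pow_ne_zero _ p.1.2.ne_zero⟩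

/-- If `p ^ k ∣ g` with `k > 0`, then both `p` and `k` are at most `p ^ k ≤ g ≤ N`. -/
theorem dvd_modulus {g N : ℕ} (hg : 0 < g) (hN : g ≤ N) : g ∣ modulus N := by
  refine (Nat.dvd_iff_prime_pow_dvd_dvd _ _).2 fun p k hp hk => ?_
  refine prime_pow_dvd_modulus_iff (p := ⟨p, hp⟩).2 ?_
  rcases Nat.eq_zero_or_pos k with rfl | hk0
  · exact Or.inl rfl
  · have h1 := (Nat.le_of_dvd hg hk).trans hN
    exact Or.inr ⟨(Nat.le_self_pow hk0.ne' p).trans h1, (Nat.lt_pow_self hp.one_lt).le.trans h1⟩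

/-- Reduction of integer vectors modulo `M`. -/
def reduceMod (d M : ℕ) : (Fin d → ℤ) →+ (Fin d → ZMod M) :=
  (Int.castAddHom (ZMod M)).compLeft (Fin d)

theorem reduceMod_apply (M : ℕ) (y : Fin d → ℤ) (i : Fin d) : reduceMod d M y i = (y i : ZMod M) :=
  rfl

theorem reduceMod_surjective (M : ℕ) : Function.Surjective (reduceMod d M) := by
  intro u
  choose y hy using fun i => ZMod.intCast_surjective (u i)
  exact ⟨y, funext hy⟩

theorem dvd_gcdLabel_add_iff {k M : ℕ} (hk : k ∣ M) {x y : Fin d → ℤ} :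
    k ∣ gcdLabel d (x + y) ↔
      ∀ i, (x i : ZMod k) + ZMod.castHom hk (ZMod k) (reduceMod d M y i) = 0 := by
  simp only [dvd_gcdLabel_iff, reduceMod_apply, map_intCast, ← ZMod.intCast_zmod_eq_zero_iff_dvd,
    Pi.add_apply, Int.cast_add]

/-- The gcd labelling of `ℤ^d`, truncated by taking the gcd with `M`, seen from a residue class. -/
def truncatedView (d M : ℕ) (u : Fin d → ZMod M) (x : Fin d → ℤ) : ℕ :=
  Nat.gcd (gcdLabel d (x + Function.surjInv (reduceMod_surjective M) u)) M

theorem dvd_truncatedView_iff {k M : ℕ} {u : Fin d → ZMod M} {x : Fin d → ℤ} :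
    k ∣ truncatedView d M u x ↔
      ∃ hk : k ∣ M, ∀ i, (x i : ZMod k) + ZMod.castHom hk (ZMod k) (u i) = 0 := by
  rw [truncatedView, Nat.dvd_gcd_iff, and_comm, ← exists_prop]
  refine exists_congr fun hk => ?_
  rw [dvd_gcdLabel_add_iff hk, Function.surjInv_eq (reduceMod_surjective M) u]

/-- The lift chosen in `truncatedView` is immaterial: a divisor of `M` sees only residues mod `M`.
-/
theorem truncatedView_reduceMod (M : ℕ) (y x : Fin d → ℤ) :
    truncatedView d M (reduceMod d M y) x = Nat.gcd (gcdLabel d (x + y)) M := by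
  refine Nat.dvd_left_iff_eq.1 fun k => ?_
  rw [dvd_truncatedView_iff, Nat.dvd_gcd_iff, and_comm (a := _ ∣ _), ← exists_prop]
  exact exists_congr fun hk => (dvd_gcdLabel_add_iff hk).symm

theorem truncatedView_reduceMod_of_le {N : ℕ} {y x : Fin d → ℤ} (h0 : gcdLabel d (x + y) ≠ 0)
    (hN : gcdLabel d (x + y) ≤ N) :
    truncatedView d (modulus N) (reduceMod d (modulus N) y) x = gcdLabel d (x + y) := by
  rw [truncatedView_reduceMod]
  exact Nat.gcd_eq_left (dvd_modulus (Nat.pos_of_ne_zero h0) hN)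

theorem pairwise_coprime_primesUpTo (N : ℕ) : Pairwise (Function.onFun Nat.Coprime
    fun p : primesUpTo N => ((p : Nat.Primes) : ℕ) ^ N) := fun p q hpq =>
  Nat.Coprime.pow _ _ <| (Nat.coprime_primes p.1.2 q.1.2).2 fun h =>
    hpq (Subtype.ext (Subtype.ext h))

/-- The Chinese remainder isomorphism for the primes up to `N`. -/
def crt (N : ℕ) : ZMod (modulus N) ≃+* ((p : primesUpTo N) → ZMod (((p : Nat.Primes) : ℕ) ^ N)) :=
  ZMod.prodEquivPi _ (pairwise_coprime_primesUpTo N)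

/-- The residue class modulo `modulus N` determined by the cosets of level `N` for the primes up to
`N`. -/
def residue (N : ℕ) (W : Chains d) : Fin d → ZMod (modulus N) :=
  fun i => (crt N).symm fun p => W p N i

theorem castHom_residue {N : ℕ} (W : Chains d) (p : primesUpTo N) (i : Fin d)
    (h : ((p : Nat.Primes) : ℕ) ^ N ∣ modulus N) :
    ZMod.castHom h (ZMod (((p : Nat.Primes) : ℕ) ^ N)) (residue N W i) = W p N i := by
  have h1 := ZMod.prodEquivPi_apply _ (pairwise_coprime_primesUpTo N) (residue N W i) p
  have h2 : crt N (residue N W i) = fun p : primesUpTo N => W p.1 N i := RingEquiv.apply_symm_apply _ _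
  exact h1.symm.trans (congrFun h2 p)

/-- Prime powers dividing either side divide `modulus N`, so have `p, k ≤ N`, where both sides test
`x ∈ W p k`. The sign turns `x ≡ residue` into `x + u ≡ 0`. -/
theorem IsRegular.truncatedView_residue {W : Chains d} (hW : IsRegular W) {N : ℕ}
    {x : Fin d → ℤ} (hN : natProfile W x ≤ N) :
    truncatedView d (modulus N) (-residue N W) x = natProfile W x := by
  obtain ⟨hg0, -, hdvd⟩ := hW.2 x
  have key : ∀ (p : Nat.Primes) (k : ℕ) (hp : (p : ℕ) ≤ N) (hk : k ≤ N),
      (p : ℕ) ^ k ∣ truncatedView d (modulus N) (-residue N W) x ↔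
        (p : ℕ) ^ k ∣ natProfile W x := by
    intro p k hp hk
    have hM : (p : ℕ) ^ k ∣ modulus N := prime_pow_dvd_modulus_iff.2 (Or.inr ⟨hp, hk⟩)
    have hM' : (p : ℕ) ^ N ∣ modulus N := prime_pow_dvd_modulus_iff.2 (Or.inr ⟨hp, le_rfl⟩)
    rw [dvd_truncatedView_iff, exists_prop_of_true hM, hdvd]
    refine forall_congr' fun i => ?_
    have h1 : ZMod.castHom hM (ZMod ((p : ℕ) ^ k)) (residue N W i) = W p k i := by
      rw [← hW.1.castHom_eq p hk i, ← castHom_residue W ⟨p, mem_primesUpTo.2 hp⟩ i hM']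
      exact RingHom.congr_fun (Subsingleton.elim _ ((ZMod.castHom (pow_dvd_pow (p : ℕ) hk) _).comp
        (ZMod.castHom hM' _))) _
    rw [Pi.neg_apply, map_neg, h1, ← sub_eq_add_neg, sub_eq_zero]
  refine Nat.dvd_antisymm ?_ ?_
  · refine (Nat.dvd_iff_prime_pow_dvd_dvd _ _).2 fun p k hp hk => ?_
    rcases Nat.eq_zero_or_pos k with rfl | hk0
    · simp
    obtain ⟨hM, -⟩ := dvd_truncatedView_iff.1 hk
    obtain ⟨hpN, hkN⟩ :=
      ((prime_pow_dvd_modulus_iff (p := ⟨p, hp⟩)).1 hM).resolve_left hk0.ne'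
    exact (key ⟨p, hp⟩ k hpN hkN).1 hk
  · refine (Nat.dvd_iff_prime_pow_dvd_dvd _ _).2 fun p k hp hk => ?_
    rcases Nat.eq_zero_or_pos k with rfl | hk0
    · simp
    obtain ⟨hpN, hkN⟩ := ((prime_pow_dvd_modulus_iff (p := ⟨p, hp⟩)).1
      (hk.trans (dvd_modulus hg0 hN))).resolve_left hk0.ne'
    exact (key ⟨p, hp⟩ k hpN hkN).2 hk

theorem measurable_residue (N : ℕ) : Measurable (residue (d := d) N) := by
  rw [measurable_pi_iff]
  intro i
  refine (Measurable.of_discrete (f := (crt N).symm)).comp ?_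
  fun_prop

/-- The Chinese remainder theorem makes the event a cylinder over the primes up to `N`; independence
multiplies the uniform probabilities. -/
theorem chainsLaw_residue_eq (N : ℕ) (u : Fin d → ZMod (modulus N)) :
    chainsLaw d {W | residue N W = u} = ((modulus N : ℝ≥0∞) ^ d)⁻¹ := by
  let t : (p : Nat.Primes) → Set ((n : ℕ) → CosetIndex d p n) := fun p =>
    if h : p ∈ primesUpTo N then {V | V N = fun i => crt N (u i) ⟨p, h⟩} else Set.univ
  have ht : ∀ p (h : p ∈ primesUpTo N), t p = {V | V N = fun i => crt N (u i) ⟨p, h⟩} :=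
    fun p h => dif_pos h
  have h1 : {W : Chains d | residue N W = u} = Set.pi (primesUpTo N) t := by
    ext W
    rw [Set.mem_pi]
    constructor
    · rintro rfl p hp
      rw [ht p hp]
      funext i
      have h2 : crt N (residue N W i) = fun p : primesUpTo N => W p.1 N i := RingEquiv.apply_symm_apply _ _
      rw [h2]
    · intro h
      funext i
      refine (RingEquiv.symm_apply_eq _).2 (funext fun p => ?_)
      have := h p.1 p.2
      rw [ht p.1 p.2] at this
      exact congrFun this i
  have h2 : ∀ p ∈ primesUpTo N, chainLaw d p (t p) = ((((p : ℕ) ^ N : ℕ) : ℝ≥0∞) ^ d)⁻¹ := by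
    intro p hp
    rw [ht p hp, chainLaw_apply_eq]
  rw [h1, chainsLaw, Measure.infinitePi_pi, Finset.prod_congr rfl h2, modulus,
    Finset.prod_coe_sort (primesUpTo N) fun p : Nat.Primes => (p : ℕ) ^ N]
  · rw [Nat.cast_prod, ← Finset.prod_pow]
    exact (ENNReal.prod_inv_distrib (fun _ _ _ _ _ => Or.inr (by simp))).symm
  · intro p hp
    rw [ht p hp]
    exact measurableSet_eq_fun (by fun_prop) (by fun_prop)

theorem chainsLaw_real_residue_mem (N : ℕ) (B : Finset (Fin d → ZMod (modulus N))) :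
    (chainsLaw d).real {W | residue N W ∈ B} =
      B.card / Fintype.card (Fin d → ZMod (modulus N)) := by
  have h1 : {W : Chains d | residue N W ∈ B} = ⋃ u ∈ B, {W | residue N W = u} := by
    ext W; simp
  rw [h1, measureReal_biUnion_finset]
  · simp only [Measure.real, chainsLaw_residue_eq]
    simp [div_eq_mul_inv, ZMod.card]
  · intro u _ v _ huv
    exact Set.disjoint_left.2 fun W hu hv => huv (hu.symm.trans hv)
  · exact fun u _ => measurable_residue N (measurableSet_singleton u)

end Truncation

/-! ### Comparison of the two laws and weak convergence. -/

section Limit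

variable {d : ℕ}

/-- Membership of a labelling in `A` depends only on the labels of the points of `S`. -/
def DependsOnlyOn (A : Set ((Fin d → ℤ) → ℕ)) (S : Finset (Fin d → ℤ)) : Prop :=
  ∀ ω ω' : (Fin d → ℤ) → ℕ, (∀ x ∈ S, ω x = ω' x) → ω ∈ A → ω' ∈ A

theorem abs_measureReal_sub_le {α ι : Type*} [MeasurableSpace α] {μ : Measure α}
    [IsFiniteMeasure μ] {s t : Set α} {S : Finset ι} {b : ι → Set α}
    (h : ∀ᵐ a ∂μ, (∀ x ∈ S, a ∉ b x) → (a ∈ s ↔ a ∈ t)) :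
    |μ.real s - μ.real t| ≤ ∑ x ∈ S, μ.real (b x) := by
  have key : ∀ s t : Set α, (∀ᵐ a ∂μ, (∀ x ∈ S, a ∉ b x) → (a ∈ s ↔ a ∈ t)) →
      μ.real s ≤ μ.real t + ∑ x ∈ S, μ.real (b x) := by
    intro s t h
    have h1 : μ s ≤ μ (t ∪ ⋃ x ∈ S, b x) := by
      refine measure_mono_ae ?_
      filter_upwards [h] with a ha hs
      by_cases hb : ∀ x ∈ S, a ∉ b x
      · exact Or.inl ((ha hb).1 hs)
      · push Not at hb
        obtain ⟨x, hx, hab⟩ := hb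
        exact Or.inr (Set.mem_biUnion hx hab)
    calc μ.real s ≤ μ.real (t ∪ ⋃ x ∈ S, b x) := ENNReal.toReal_mono (measure_ne_top _ _) h1
      _ ≤ μ.real t + μ.real (⋃ x ∈ S, b x) := measureReal_union_le _ _
      _ ≤ _ := by
        gcongr
        exact measureReal_biUnion_finset_le _ _
  rw [abs_le]
  have h1 := key s t h
  have h2 := key t s (h.mono fun a ha hb => (ha hb).symm)
  constructor <;> linarith

open Classical in
/-- The residue classes whose truncated labelling lies in `A`. -/
def goodResidues (N : ℕ) (A : Set ((Fin d → ℤ) → ℕ)) : Finset (Fin d → ZMod (modulus N)) :=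
  Finset.univ.filter fun u => truncatedView d (modulus N) u ∈ A

theorem mem_goodResidues {N : ℕ} {A : Set ((Fin d → ℤ) → ℕ)} {u : Fin d → ZMod (modulus N)} :
    u ∈ goodResidues N A ↔ truncatedView d (modulus N) u ∈ A := by
  simp [goodResidues]

theorem DependsOnlyOn.abs_chainsLaw_sub_le (hd : 2 ≤ d) {A : Set ((Fin d → ℤ) → ℕ)}
    {S : Finset (Fin d → ℤ)} (hA : DependsOnlyOn A S) (N : ℕ) :
    |(chainsLaw d).real {W | natProfile W ∈ A} -
        (goodResidues N A).card / Fintype.card (Fin d → ZMod (modulus N))| ≤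
      ∑ x ∈ S, (chainsLaw d).real {W | N < natProfile W x} := by
  have h1 : ((goodResidues N A).card : ℝ) / Fintype.card (Fin d → ZMod (modulus N)) =
      (chainsLaw d).real {W | -residue N W ∈ goodResidues N A} := by
    -- Negation preserves the uniform law on residues, so the sign is harmless.
    rw [← Finset.card_map (Equiv.neg _).toEmbedding, ← chainsLaw_real_residue_mem]
    congr 1
    ext W
    simp
  rw [h1]
  refine abs_measureReal_sub_le ?_
  filter_upwards [ae_isRegular hd] with W hW hS
  simp only [not_lt, mem_goodResidues] at hS ⊢
  have h2 : ∀ x ∈ S, truncatedView d (modulus N) (-residue N W) x = natProfile W x :=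
    fun x hx => hW.truncatedView_residue (hS x hx)
  exact ⟨hA _ _ fun x hx => (h2 x hx).symm, hA _ _ h2⟩

theorem tendsto_chainsLaw_real_lt_natProfile (x : Fin d → ℤ) :
    Tendsto (fun N : ℕ => (chainsLaw d).real {W | N < natProfile W x}) atTop (𝓝 0) := by
  have hm : Measurable fun W : Chains d => natProfile W x :=
    measurable_pi_iff.1 measurable_natProfile x
  have h1 := tendsto_measure_iInter_atTop (μ := chainsLaw d)
    (s := fun N : ℕ => {W : Chains d | N < natProfile W x})
    (fun N => (hm (MeasurableSet.of_discrete (s := Set.Ioi N))).nullMeasurableSet)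
    (fun a b hab W hW => lt_of_le_of_lt hab hW) ⟨0, measure_ne_top _ _⟩
  have h2 : ⋂ N : ℕ, {W : Chains d | N < natProfile W x} = ∅ := by
    ext W
    simp only [Set.mem_iInter, Set.mem_ofPred_eq, Set.mem_empty_iff_false, iff_false, not_forall,
      not_lt]
    exact ⟨_, le_rfl⟩
  rw [h2, measure_empty] at h1
  have h3 := (ENNReal.tendsto_toReal ENNReal.zero_ne_top).comp h1
  rw [ENNReal.toReal_zero] at h3
  exact h3

theorem uniformOn_real_apply {α : Type*} [MeasurableSpace α] [MeasurableSingletonClass α]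
    (A : Finset α) (s : Set α) [DecidablePred (· ∈ s)] :
    (uniformOn (A : Set α)).real s = ((A.filter (· ∈ s)).card : ℝ) / A.card := by
  classical
  rw [Measure.real, ← uniformOn_inter_self A.finite_toSet]
  have : (A : Set α) ∩ s = (A.filter (· ∈ s) : Finset α) := by
    ext; simp
  rw [this, uniformOn_apply_finset, Finset.inter_eq_right.2 (Finset.filter_subset _ _)]
  simp

theorem gcdView_real_apply {A : Finset (Fin d → ℤ)} (hA : A.Nonempty)
    {E : Set ((Fin d → ℤ) → ℕ)} (hE : MeasurableSet E) :
    (gcdView d A : Measure ((Fin d → ℤ) → ℕ)).real E =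
      (uniformOn (A : Set (Fin d → ℤ))).real {y | (fun x => gcdLabel d (x + y)) ∈ E} := by
  have h1 : (A : Set (Fin d → ℤ)).Finite ∧ (A : Set (Fin d → ℤ)).Nonempty :=
    ⟨A.finite_toSet, by simpa using hA⟩
  have h2 : (gcdView d A : Measure ((Fin d → ℤ) → ℕ)) = gcdViewMeasure d A :=
    congrArg Subtype.val (show gcdView d A = ⟨gcdViewMeasure d A, _⟩ from dif_pos h1)
  rw [h2, gcdViewMeasure, map_measureReal_apply Measurable.of_discrete hE]
  congr 1
  ext y
  have h3 : translate (-y) (gcdLabel d) = fun x => gcdLabel d (x + y) := by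
    funext x
    rw [translate, sub_neg_eq_add]
  rw [Set.mem_preimage, h3, Set.mem_ofPred_eq]

theorem DependsOnlyOn.abs_gcdView_sub_le {E : Set ((Fin d → ℤ) → ℕ)} {S : Finset (Fin d → ℤ)}
    (hE : DependsOnlyOn E S) (hEm : MeasurableSet E) {A : Finset (Fin d → ℤ)} (hA : A.Nonempty)
    (N : ℕ) :
    |(gcdView d A : Measure ((Fin d → ℤ) → ℕ)).real E -
        ((A.filter fun z => reduceMod d (modulus N) z ∈ goodResidues N E).card : ℝ) / A.card| ≤
      ∑ x ∈ S, ((A.filter fun z => gcdLabel d (x + z) = 0 ∨ N < gcdLabel d (x + z)).card : ℝ) /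
        A.card := by
  have : IsProbabilityMeasure (uniformOn (A : Set (Fin d → ℤ))) :=
    isProbabilityMeasure_uniformOn A.finite_toSet (by simpa using hA)
  have h1 := uniformOn_real_apply A {z | reduceMod d (modulus N) z ∈ goodResidues N E}
  have h2 := fun x => uniformOn_real_apply A
    {z | gcdLabel d (x + z) = 0 ∨ N < gcdLabel d (x + z)}
  simp only [Set.mem_ofPred_eq] at h1 h2
  rw [gcdView_real_apply hA hEm, ← h1, ← Finset.sum_congr rfl fun x _ => h2 x]
  refine abs_measureReal_sub_le (Eventually.of_forall fun z hz => ?_)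
  simp only [Set.mem_ofPred_eq, not_or, not_lt, mem_goodResidues] at hz ⊢
  have h3 : ∀ x ∈ S, truncatedView d (modulus N) (reduceMod d (modulus N) z) x =
      gcdLabel d (x + z) := fun x hx => truncatedView_reduceMod_of_le (hz x hx).1 (hz x hx).2
  exact ⟨hE _ _ fun x hx => (h3 x hx).symm, hE _ _ h3⟩

/-- First `N` is fixed so that both truncation errors together are below `ε / 2`; then `r → ∞`
equidistributes residues mod `modulus N` within `ε / 2`. -/
theorem DependsOnlyOn.tendsto_gcdView_real (hd : 2 ≤ d) {E : Set ((Fin d → ℤ) → ℕ)}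
    {S : Finset (Fin d → ℤ)} (hE : DependsOnlyOn E S) (hEm : MeasurableSet E)
    {F : Set (EuclideanSpace ℝ (Fin d))} (hFb : Bornology.IsBounded F) (hFc : Convex ℝ F)
    (hFi : (interior F).Nonempty) {A : ℝ → Finset (Fin d → ℤ)}
    (hA : ∀ r, 0 < r → (A r : Set (Fin d → ℤ)) = latticePoints F r)
    (hne : ∀ᶠ r in atTop, (A r).Nonempty) :
    Tendsto (fun r => (gcdView d (A r) : Measure ((Fin d → ℤ) → ℕ)).real E) atTop
      (𝓝 ((chainsLaw d).real {W | natProfile W ∈ E})) := by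
  obtain ⟨C, hC⟩ := exists_card_filter_gcdLabel_div_le hd hFb hFi hA
  have htail : Tendsto (fun N : ℕ => ∑ x ∈ S, C / ((N : ℝ) + 1) +
      ∑ x ∈ S, (chainsLaw d).real {W | N < natProfile W x}) atTop (𝓝 0) := by
    have h1 : Tendsto (fun N : ℕ => C / ((N : ℝ) + 1)) atTop (𝓝 0) :=
      tendsto_const_nhds.div_atTop (tendsto_atTop_add_const_right _ _ tendsto_natCast_atTop_atTop)
    simpa using (tendsto_finsetSum S fun _ _ => h1).add
      (tendsto_finsetSum S fun x _ => tendsto_chainsLaw_real_lt_natProfile x)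
  rw [Metric.tendsto_nhds]
  intro ε hε
  obtain ⟨N, hN⟩ := (htail.eventually_lt_const (half_pos hε)).exists
  have hequi := tendsto_card_filter_map_mem_div
    (tendsto_shiftLoss_latticePoints hFb hFc hFi hA) hne (reduceMod d (modulus N))
    (reduceMod_surjective _) (goodResidues N E)
  have hbad : ∀ᶠ r in atTop, ∀ x ∈ S,
      (((A r).filter fun z => gcdLabel d (x + z) = 0 ∨ N < gcdLabel d (x + z)).card : ℝ) /
        (A r).card ≤ C / (N + 1) := (Finset.eventually_all S).2 fun x _ => hC x N
  filter_upwards [hne, hbad, Metric.tendsto_nhds.1 hequi _ (half_pos hε)] with r hr hbad heq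
  have h1 := hE.abs_gcdView_sub_le hEm hr N
  have h2 := hE.abs_chainsLaw_sub_le hd N
  have h3 := Finset.sum_le_sum hbad
  rw [Real.dist_eq] at heq ⊢
  rw [abs_le] at h1 h2
  rw [abs_lt] at heq ⊢
  constructor <;> linarith [h1.1, h1.2, h2.1, h2.2, heq.1, heq.2]

/-- The law of the random gcd profile, on labellings by natural numbers. -/
def natProfileLaw (d : ℕ) : ProbabilityMeasure ((Fin d → ℤ) → ℕ) :=
  ⟨(chainsLaw d).map natProfile,
    Measure.isProbabilityMeasure_map measurable_natProfile.aemeasurable⟩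

/-- `ENat.toNat` sends `⊤` to `0`, but the profile is almost surely finite everywhere, so nothing is
lost. -/
theorem map_natProfileLaw (hd : 2 ≤ d) :
    (natProfileLaw d : Measure ((Fin d → ℤ) → ℕ)).map (fun ω x => (ω x : ℕ∞)) =
      gcdProfileLaw d := by
  have hm : Measurable fun (ω : (Fin d → ℤ) → ℕ) x => (ω x : ℕ∞) :=
    measurable_pi_iff.2 fun x =>
      (Measurable.of_discrete (f := fun n : ℕ => (n : ℕ∞))).comp (measurable_pi_apply x)
  change ((chainsLaw d).map natProfile).map _ = _
  rw [Measure.map_map hm measurable_natProfile, gcdProfileLaw]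
  refine Measure.map_congr ?_
  filter_upwards [ae_isRegular hd] with W hW
  funext x
  exact (hW.2 x).2.1.symm

/-- Measurable cylinders form a π-system, and those fixing finitely many labels give neighbourhoods
inside any open set, so convergence on cylinders is enough. -/
theorem tendsto_gcdView (hd : 2 ≤ d)
    {F : Set (EuclideanSpace ℝ (Fin d))} (hFb : Bornology.IsBounded F) (hFc : Convex ℝ F)
    (hFi : (interior F).Nonempty) {A : ℝ → Finset (Fin d → ℤ)}
    (hA : ∀ r, 0 < r → (A r : Set (Fin d → ℤ)) = latticePoints F r)
    (hne : ∀ᶠ r in atTop, (A r).Nonempty) :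
    Tendsto (fun r => gcdView d (A r)) atTop (𝓝 (natProfileLaw d)) := by
  refine (isPiSystem_measurableCylinders (α := fun _ : Fin d → ℤ => ℕ)
    ).tendsto_probabilityMeasure_of_tendsto_of_mem
    (fun s hs => MeasurableSet.of_mem_measurableCylinders hs) (fun u hu ω hω => ?_)
    (fun s hs => ?_)
  · obtain ⟨I, U, hU, hIU⟩ := isOpen_pi_iff.1 hu ω hω
    refine ⟨cylinder I {I.restrict ω}, cylinder_mem_measurableCylinders _ _
      (measurableSet_singleton _), ?_, fun ω' hω' => hIU fun x hx => ?_⟩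
    · refine IsOpen.mem_nhds ?_ (by simp)
      exact (isOpen_discrete {I.restrict ω}).preimage (by fun_prop)
    · rw [mem_cylinder, Set.mem_singleton_iff] at hω'
      have h1 : ω' x = ω x := congrFun hω' ⟨x, hx⟩
      rw [h1]
      exact (hU x hx).2
  · have hsm : MeasurableSet s := MeasurableSet.of_mem_measurableCylinders hs
    obtain ⟨I, T, -, rfl⟩ := (mem_measurableCylinders _).1 hs
    have hdep : DependsOnlyOn (cylinder I T) I := by
      intro ω ω' h hω
      rw [mem_cylinder] at hω ⊢
      have : I.restrict ω' = I.restrict ω := funext fun x => (h x x.2).symm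
      rwa [this]
    have h1 := hdep.tendsto_gcdView_real hd hsm hFb hFc hFi hA hne
    have h2 : (natProfileLaw d : Measure ((Fin d → ℤ) → ℕ)).real (cylinder I T) =
        (chainsLaw d).real {W | natProfile W ∈ cylinder I T} :=
      map_measureReal_apply measurable_natProfile hsm
    rw [← h2] at h1
    exact NNReal.tendsto_coe.1 h1

end Limit

end GcdLabelling

end

theorem theorem1 (d : ℕ) (hd : 2 ≤ d) :
    ∃ μ : ProbabilityMeasure ((Fin d → ℤ) → ℕ),
      (μ : Measure ((Fin d → ℤ) → ℕ)).map (fun ω x => (ω x : ℕ∞)) =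
          GcdLabelling.gcdProfileLaw d ∧
      ∀ F : Set (EuclideanSpace ℝ (Fin d)),
        Bornology.IsBounded F → Convex ℝ F → (interior F).Nonempty →
          (∀ᶠ r : ℝ in atTop, (GcdLabelling.latticePoints F r).Finite ∧
            (GcdLabelling.latticePoints F r).Nonempty) ∧
          Tendsto (fun r : ℝ => GcdLabelling.gcdView d (GcdLabelling.latticePoints F r))
            atTop (𝓝 μ) := by
  refine ⟨GcdLabelling.natProfileLaw d, GcdLabelling.map_natProfileLaw hd,
    fun F hFb hFc hFi => ?_⟩
  obtain ⟨K, -, hK⟩ := GcdLabelling.exists_latticePoints_subset_box hFb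
  have hfin : ∀ r : ℝ, 0 < r → (GcdLabelling.latticePoints F r).Finite := fun r hr =>
    (Finset.finite_toSet _).subset (hK r hr)
  -- Positivity matters: at `r = 0` the convention `0⁻¹ = 0` gives all of `ℤ^d` when `0 ∈ F`.
  have hex : ∀ r : ℝ, ∃ A : Finset (Fin d → ℤ), 0 < r →
      (A : Set (Fin d → ℤ)) = GcdLabelling.latticePoints F r := by
    intro r
    by_cases hr : 0 < r
    · exact ⟨(hfin r hr).toFinset, fun _ => (hfin r hr).coe_toFinset⟩
    · exact ⟨∅, fun h => absurd h hr⟩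
  choose A hA using hex
  have hne : ∀ᶠ r in atTop, (A r).Nonempty := by
    filter_upwards [(GcdLabelling.tendsto_card_atTop (by omega) hFi hA).eventually_gt_atTop 0]
      with r hr
    exact Finset.card_pos.1 (by exact_mod_cast hr)
  refine ⟨?_, ?_⟩
  · filter_upwards [hne, eventually_gt_atTop 0] with r hr hr0
    exact ⟨hfin r hr0, by rw [← hA r hr0]; simpa using hr⟩
  · refine (GcdLabelling.tendsto_gcdView hd hFb hFc hFi hA hne).congr' ?_
    filter_upwards [eventually_gt_atTop 0] with r hr
    rw [hA r hr]
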